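/- Let $\alpha\in\mathbb R$, and let $\mu\ge 0$ be a $\sigma$-finite Borel measure supported on $\mathbb R_-=(-\infty,0)$ such that $\int_{\mathbb R_-} e^{tp}\,d\mu(p)<\infty$ for all $t>0$. Put $h(t)=\int_{\mathbb R_-}e^{tp}\,d\mu(p)$ and $w(t)=t^\alpha$ for $t>0$, and let $\Gamma_{h,w}$ be the weighted Hankel operator $$(\Gamma_{h,w}u)(t)=\int_0^\infty w(t)\,h(t+\tau)\,w(\tau)\,u(\tau)\,d\tau .$$ It is called bounded on $L^2(0,\infty)$ if for every $u\in L^2(0,\infty)$ this integral converges absolutely for almost every $t>0$, and $\|\Gamma_{h,w}u\|_{L^2(0,\infty)}\le C\|u\|_{L^2(0,\infty)}$ with a finite constant $C$ independent of $u$. (i) If $-1/2<\alpha<0$, then $\Gamma_{h,w}$ is bounded on $L^2(0,\infty)$ if and only if there is a $\gamma>0$ such that $\mu((-2x,-x))\le\gamma x^{1+2\alpha}$ for all $x>0$. (ii) If $\alpha=0$, then $\Gamma_{h,w}$ is bounded on $L^2(0,\infty)$ if and only if there is a $\gamma>0$ such that $\mu((-x,0))\le\gamma x$ for all $x>0$.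 (iii) If $\alpha>0$, then $\Gamma_{h,w}$ is bounded on $L^2(0,\infty)$ if and only if there is a $\gamma>0$ such that $\mu((-x,0))\le\gamma x^{1+2\alpha}$ for all $x>0$. -/

import Mathlib

open MeasureTheory Set
open scoped NNReal ENNReal

noncomputable section

/-- The Fourier--Borel transform `h(t) = ∫ e^{tp} dμ(p)` of a positive measure `μ` carried by
the negative half-line, viewed as a measure on the real line. -/
def impulseResponse (μ : Measure ℝ) (t : ℝ) : ℝ :=
  ∫ p, Real.exp (t * p) ∂μ

/-- Lebesgue measure on `(0, ∞)`. -/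
def halfLine : Measure ℝ := volume.restrict (Ioi 0)

/-- The integrand `τ ↦ w(t) h(t+τ) w(τ) u(τ)` of the weighted Hankel operator. -/
def hankelIntegrand (h w : ℝ → ℝ) (u : ℝ → ℂ) (t τ : ℝ) : ℂ :=
  ((w t * h (t + τ) * w τ : ℝ) : ℂ) * u τ

/-- The weighted Hankel operator
`(Γ_{h,w} u)(t) = ∫_0^∞ w(t) h(t+τ) w(τ) u(τ) dτ`. -/
def weightedHankel (h w : ℝ → ℝ) (u : ℝ → ℂ) (t : ℝ) : ℂ :=
  ∫ τ, hankelIntegrand h w u t τ ∂halfLine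

/-- `Γ_{h,w}` is a bounded operator on the complex space `L²(0, ∞)`: for every `u ∈ L²(0, ∞)`
the defining integral converges absolutely for almost every `t > 0`, the function so obtained
is in `L²(0, ∞)`, and its norm is at most a constant (independent of `u`) times that of `u`. -/
def IsBoundedHankel (h w : ℝ → ℝ) : Prop :=
  ∃ C : ℝ≥0, ∀ u : ℝ → ℂ, MemLp u 2 halfLine →
    (∀ᵐ t ∂halfLine, Integrable (hankelIntegrand h w u t) halfLine) ∧
    MemLp (weightedHankel h w u) 2 halfLine ∧
    eLpNorm (weightedHankel h w u) 2 halfLine ≤ C * eLpNorm u 2 halfLine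

end

/-! For every `α > -1/2`, boundedness, the decay `h(t) ≤ B t^{-(1+2α)}` and the growth `μ((-x,0)) ≤
γ x^{1+2α}` are equivalent, which covers all three cases at once. Growth gives decay by slicing the
Laplace integral into layers of `t|p|`. Decay gives boundedness by Schur's test: the majorant
`(tτ)^α (t+τ)^{-(1+2α)}` is homogeneous of degree -1, so `t^{-1/2}` is the natural weight.
Conversely, testing on the indicator of `(x,2x)` recovers the decay, since `h` is decreasing, and a
Markov-type bound turns decay into growth. In case (i), `1+2α > 0` lets a geometric series pass from
the intervals `(-2x,-x)` to `(-x,0)`. -/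

/-! ### Schur's test and the homogeneous kernel -/

/-- Cauchy–Schwarz applied to the splitting `k f = (k q)^{1/2} · (k/q)^{1/2} f`. -/
theorem ENNReal.sq_lintegral_mul_le_weighted {X : Type*} [MeasurableSpace X] {ν : Measure X}
    {k q f : X → ℝ≥0∞} (hk : AEMeasurable k ν) (hq : AEMeasurable q ν) (hf : AEMeasurable f ν)
    (hq0 : ∀ᵐ x ∂ν, q x ≠ 0 ∧ q x ≠ ∞) :
    (∫⁻ x, k x * f x ∂ν) ^ 2 ≤ (∫⁻ x, k x * q x ∂ν) * ∫⁻ x, k x * (q x)⁻¹ * f x ^ 2 ∂ν := by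
  have hs (y : ℝ≥0∞) : (y ^ (1 / 2 : ℝ)) ^ (2 : ℝ) = y := by
    rw [← ENNReal.rpow_mul]; norm_num
  have hs' (y : ℝ≥0∞) : (y ^ (1 / 2 : ℝ)) ^ (2 : ℕ) = y := by
    rw [← ENNReal.rpow_natCast, Nat.cast_ofNat, hs]
  have H := ENNReal.lintegral_mul_le_Lp_mul_Lq ν Real.HolderConjugate.two_two
    (f := fun x => (k x * q x) ^ (1 / 2 : ℝ)) (g := fun x => (k x * (q x)⁻¹) ^ (1 / 2 : ℝ) * f x)
    ((hk.mul hq).pow_const _) (((hk.mul hq.inv).pow_const _).mul hf)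
  have e : ∫⁻ x, ((fun x => (k x * q x) ^ (1 / 2 : ℝ)) *
      fun x => (k x * (q x)⁻¹) ^ (1 / 2 : ℝ) * f x) x ∂ν = ∫⁻ x, k x * f x ∂ν := by
    refine lintegral_congr_ae ?_
    filter_upwards [hq0] with x hx
    simp only [Pi.mul_apply]
    rw [← mul_assoc, ← ENNReal.mul_rpow_of_nonneg _ _ (by norm_num)]
    have : k x * q x * (k x * (q x)⁻¹) = k x ^ (2 : ℝ) := by
      rw [mul_mul_mul_comm, ENNReal.mul_inv_cancel hx.1 hx.2, mul_one, ← sq]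
      norm_num
    rw [this, ← ENNReal.rpow_mul]; norm_num
  rw [e] at H
  calc _ ≤ _ := pow_le_pow_left' H 2
    _ = _ := by
      rw [mul_pow, hs', hs']
      simp_rw [ENNReal.mul_rpow_of_nonneg _ (f _) zero_le_two, hs, ENNReal.rpow_two]

/-- **Schur's test** on `L²`. -/
theorem lintegral_sq_lintegral_mul_le_of_schur {X : Type*} [MeasurableSpace X] {ν : Measure X}
    [SFinite ν] {k : X → X → ℝ≥0∞} {q f : X → ℝ≥0∞} (A : ℝ≥0∞)
    (hk : Measurable (Function.uncurry k)) (hq : Measurable q) (hf : AEMeasurable f ν)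
    (hq0 : ∀ᵐ x ∂ν, q x ≠ 0 ∧ q x ≠ ∞)
    (hrow : ∀ᵐ x ∂ν, ∫⁻ y, k x y * q y ∂ν ≤ A * q x)
    (hcol : ∀ᵐ y ∂ν, ∫⁻ x, k x y * q x ∂ν ≤ A * q y) :
    ∫⁻ x, (∫⁻ y, k x y * f y ∂ν) ^ 2 ∂ν ≤ A ^ 2 * ∫⁻ y, f y ^ 2 ∂ν := by
  have hmeas : AEMeasurable (fun z : X × X => q z.1 * (k z.1 z.2 * (q z.2)⁻¹ * f z.2 ^ 2))
      (ν.prod ν) :=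
    (hq.comp measurable_fst).aemeasurable.mul
      ((hk.aemeasurable.mul (hq.comp measurable_snd).inv.aemeasurable).mul
        (hf.comp_snd.pow_const 2))
  have hkf (x : X) : Measurable (k x) := hk.of_uncurry_left
  have hkr (y : X) : Measurable (fun x => k x y) := hk.of_uncurry_right
  have hg (x : X) : AEMeasurable (fun y => k x y * (q y)⁻¹ * f y ^ 2) ν :=
    ((hkf x).mul hq.inv).aemeasurable.mul (hf.pow_const 2)
  have hinner : ∀ᵐ x ∂ν, (∫⁻ y, k x y * f y ∂ν) ^ 2 ≤
      A * ∫⁻ y, q x * (k x y * (q y)⁻¹ * f y ^ 2) ∂ν := by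
    filter_upwards [hrow] with x hx
    rw [lintegral_const_mul'' _ (hg x), ← mul_assoc]
    exact (ENNReal.sq_lintegral_mul_le_weighted (hkf x).aemeasurable hq.aemeasurable hf hq0).trans
      (by gcongr)
  calc _ ≤ ∫⁻ x, A * ∫⁻ y, q x * (k x y * (q y)⁻¹ * f y ^ 2) ∂ν ∂ν := lintegral_mono_ae hinner
    _ = A * ∫⁻ x, ∫⁻ y, q x * (k x y * (q y)⁻¹ * f y ^ 2) ∂ν ∂ν :=
      lintegral_const_mul'' _ hmeas.lintegral_prod_right'
    _ = A * ∫⁻ y, ∫⁻ x, q x * (k x y * (q y)⁻¹ * f y ^ 2) ∂ν ∂ν := by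
      rw [lintegral_lintegral_swap hmeas]
    _ ≤ A * ∫⁻ y, A * f y ^ 2 ∂ν := by
      gcongr 1
      refine lintegral_mono_ae ?_
      filter_upwards [hcol, hq0] with y hy hy0
      have : ∀ x, q x * (k x y * (q y)⁻¹ * f y ^ 2) = k x y * q x * ((q y)⁻¹ * f y ^ 2) :=
        fun x => by ring
      simp_rw [this]
      rw [lintegral_mul_const (f := fun x => k x y * q x) _ ((hkr y).mul hq)]
      calc _ ≤ A * q y * ((q y)⁻¹ * f y ^ 2) := by gcongr
        _ = A * (q y * (q y)⁻¹) * f y ^ 2 := by ring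
        _ = _ := by rw [ENNReal.mul_inv_cancel hy0.1 hy0.2, mul_one]
    _ = _ := by rw [lintegral_const_mul'' _ (hf.pow_const 2), ← mul_assoc, sq]

/-- Split at `τ = t` and replace `t + τ` by the larger variable. The condition `α > -1/2` makes the
powers integrable at 0 and at infinity; each piece contributes `t^{-1/2}/(α+1/2)`. -/
theorem lintegral_Ioi_rpow_mul_rpow_add_le {α : ℝ} (hα : -1 / 2 < α) {t : ℝ} (ht : 0 < t) :
    ∫⁻ τ in Ioi 0, ENNReal.ofReal (t ^ α * τ ^ α * (t + τ) ^ (-(1 + 2 * α)))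
        * ENNReal.ofReal (τ ^ (-1 / 2 : ℝ)) ≤
      ENNReal.ofReal (2 / (α + 1 / 2)) * ENNReal.ofReal (t ^ (-1 / 2 : ℝ)) := by
  have ha : 0 < α + 1 / 2 := by linarith
  have hIoc : ∫⁻ τ in Ioc 0 t, ENNReal.ofReal (t ^ α * τ ^ α * (t + τ) ^ (-(1 + 2 * α)))
        * ENNReal.ofReal (τ ^ (-1 / 2 : ℝ)) ≤
        ENNReal.ofReal (t ^ (-1 / 2 : ℝ) / (α + 1 / 2)) := by
    have hint : IntegrableOn (fun τ : ℝ => t ^ (-1 - α) * τ ^ (α - 1 / 2)) (Ioc 0 t) := by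
      rw [← intervalIntegrable_iff_integrableOn_Ioc_of_le ht.le]
      exact (intervalIntegral.intervalIntegrable_rpow' (by linarith)).const_mul _
    calc _ ≤ ∫⁻ τ in Ioc 0 t, ENNReal.ofReal (t ^ (-1 - α) * τ ^ (α - 1 / 2)) := by
          refine setLIntegral_mono' measurableSet_Ioc fun τ hτ => ?_
          have hτ0 : 0 < τ := hτ.1
          rw [← ENNReal.ofReal_mul (by positivity)]
          refine ENNReal.ofReal_le_ofReal ?_
          have h1 : (t + τ) ^ (-(1 + 2 * α)) ≤ t ^ (-(1 + 2 * α)) :=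
            Real.rpow_le_rpow_of_nonpos ht (by linarith) (by linarith)
          calc _ ≤ t ^ α * τ ^ α * t ^ (-(1 + 2 * α)) * τ ^ (-1 / 2 : ℝ) := by gcongr
            _ = (t ^ α * t ^ (-(1 + 2 * α))) * (τ ^ α * τ ^ (-1 / 2 : ℝ)) := by ring
            _ = _ := by
              rw [← Real.rpow_add ht, ← Real.rpow_add hτ0]
              ring_nf
      _ = ENNReal.ofReal (∫ τ in Ioc 0 t, t ^ (-1 - α) * τ ^ (α - 1 / 2)) := by
          rw [ofReal_integral_eq_lintegral_ofReal hint]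
          filter_upwards [ae_restrict_mem measurableSet_Ioc] with τ hτ
          have hτ0 : 0 < τ := hτ.1
          simp only [Pi.zero_apply]
          positivity
      _ = _ := by
          congr 1
          rw [← intervalIntegral.integral_of_le ht.le, intervalIntegral.integral_const_mul,
            integral_rpow (Or.inl (by linarith)), Real.zero_rpow (by linarith), sub_zero,
            mul_div_assoc', ← Real.rpow_add ht]
          ring_nf
  have hIoi : ∫⁻ τ in Ioi t, ENNReal.ofReal (t ^ α * τ ^ α * (t + τ) ^ (-(1 + 2 * α)))
        * ENNReal.ofReal (τ ^ (-1 / 2 : ℝ)) ≤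
        ENNReal.ofReal (t ^ (-1 / 2 : ℝ) / (α + 1 / 2)) := by
    have hint : IntegrableOn (fun τ : ℝ => t ^ α * τ ^ (-3 / 2 - α)) (Ioi t) :=
      (integrableOn_Ioi_rpow_of_lt (by linarith) ht).const_mul _
    calc _ ≤ ∫⁻ τ in Ioi t, ENNReal.ofReal (t ^ α * τ ^ (-3 / 2 - α)) := by
          refine setLIntegral_mono' measurableSet_Ioi fun τ hτ => ?_
          have hτ0 : 0 < τ := ht.trans hτ
          rw [← ENNReal.ofReal_mul (by positivity)]
          refine ENNReal.ofReal_le_ofReal ?_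
          have h1 : (t + τ) ^ (-(1 + 2 * α)) ≤ τ ^ (-(1 + 2 * α)) :=
            Real.rpow_le_rpow_of_nonpos hτ0 (by linarith) (by linarith)
          calc _ ≤ t ^ α * τ ^ α * τ ^ (-(1 + 2 * α)) * τ ^ (-1 / 2 : ℝ) := by gcongr
            _ = t ^ α * (τ ^ α * τ ^ (-(1 + 2 * α)) * τ ^ (-1 / 2 : ℝ)) := by ring
            _ = _ := by
              rw [← Real.rpow_add hτ0, ← Real.rpow_add hτ0]
              ring_nf
      _ = ENNReal.ofReal (∫ τ in Ioi t, t ^ α * τ ^ (-3 / 2 - α)) := by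
          rw [ofReal_integral_eq_lintegral_ofReal hint]
          filter_upwards [ae_restrict_mem measurableSet_Ioi] with τ hτ
          have hτ0 : 0 < τ := ht.trans hτ
          simp only [Pi.zero_apply]
          positivity
      _ = _ := by
          congr 1
          rw [integral_const_mul, integral_Ioi_rpow_of_lt (by linarith) ht,
            mul_div_assoc', mul_neg, ← Real.rpow_add ht,
            show -3 / 2 - α + 1 = -(α + 1 / 2) by ring, neg_div_neg_eq]
          ring_nf
  rw [← Ioc_union_Ioi_eq_Ioi ht.le]
  refine (lintegral_union_le _ _ _).trans ((add_le_add hIoc hIoi).trans_eq ?_)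
  rw [← ENNReal.ofReal_add (by positivity) (by positivity), ← ENNReal.ofReal_mul (by positivity)]
  ring_nf

/-! ### Growth of the measure near 0 and decay of its transform -/

theorem exists_measure_Ioo_zero_le {β γ : ℝ} (hβ : 0 < β) (hγ : 0 < γ) {μ : Measure ℝ}
    (h : ∀ x : ℝ, 0 < x → μ (Ioo (-2 * x) (-x)) ≤ ENNReal.ofReal (γ * x ^ β)) :
    ∃ δ : ℝ, 0 < δ ∧ ∀ x : ℝ, 0 < x → μ (Ioo (-x) 0) ≤ ENNReal.ofReal (δ * x ^ β) := by
  set r : ℝ := (2 / 3) ^ β with hr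
  have hr0 : 0 < r := by positivity
  have hr1 : r < 1 := Real.rpow_lt_one (by norm_num) (by norm_num) hβ
  have hr2 : 0 < 1 - r := by linarith
  refine ⟨γ * (1 - r)⁻¹, by positivity, fun x hx => ?_⟩
  -- Ratio 2/3 instead of 1/2 makes consecutive open intervals overlap, so no endpoint, which might
  -- be an atom, is missed.
  have hcover : Ioo (-x) 0 ⊆
      ⋃ k : ℕ, Ioo (-2 * (x * (2 / 3) ^ (k + 1))) (-(x * (2 / 3) ^ (k + 1))) := by
    intro p hp
    obtain ⟨k, hk1, hk2⟩ := exists_nat_pow_near_of_lt_one (x := -p / x) (y := 2 / 3)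
      (div_pos (by linarith [hp.2]) hx) ((div_le_one hx).2 (by linarith [hp.1]))
      (by norm_num) (by norm_num)
    rw [lt_div_iff₀ hx] at hk1
    rw [div_le_iff₀ hx] at hk2
    have : 0 < (2 / 3 : ℝ) ^ k * x := by positivity
    rw [pow_succ] at hk1
    refine mem_iUnion.2 ⟨k, ?_, ?_⟩ <;> rw [pow_succ] <;> linarith
  have hterm (k : ℕ) : γ * (x * (2 / 3) ^ (k + 1)) ^ β ≤ γ * x ^ β * r ^ k := by
    rw [Real.mul_rpow hx.le (by positivity), hr, ← Real.rpow_natCast_mul (by norm_num),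
      ← Real.rpow_mul_natCast (by norm_num), mul_assoc]
    gcongr γ * (x ^ β * ?_)
    refine Real.rpow_le_rpow_of_exponent_ge (by norm_num) (by norm_num) ?_
    push_cast; nlinarith
  calc _ ≤ ∑' k : ℕ, μ (Ioo (-2 * (x * (2 / 3) ^ (k + 1))) (-(x * (2 / 3) ^ (k + 1)))) :=
        (measure_mono hcover).trans (measure_iUnion_le _)
    _ ≤ ∑' k : ℕ, ENNReal.ofReal (γ * x ^ β * r ^ k) :=
        ENNReal.tsum_le_tsum fun k => (h _ (by positivity)).trans
          (ENNReal.ofReal_le_ofReal (hterm k))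
    _ = ENNReal.ofReal (γ * (1 - r)⁻¹ * x ^ β) := by
        rw [← ENNReal.ofReal_tsum_of_nonneg (fun k => by positivity)
          ((summable_geometric_of_lt_one hr0.le hr1).mul_left _), tsum_mul_left,
          tsum_geometric_of_lt_one hr0.le hr1]
        ring_nf

theorem exists_impulseResponse_le {β γ : ℝ} (hγ : 0 < γ) {μ : Measure ℝ}
    (hsupp : μ (Ici 0) = 0)
    (h : ∀ x : ℝ, 0 < x → μ (Ioo (-x) 0) ≤ ENNReal.ofReal (γ * x ^ β)) :
    ∃ B : ℝ, 0 < B ∧ ∀ t : ℝ, 0 < t → impulseResponse μ t ≤ B * t ^ (-β) := by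
  obtain ⟨n, hn⟩ := exists_nat_ge β
  have hsum : Summable fun k : ℕ => Real.exp (-k) * ((k : ℝ) + 2) ^ n := by
    have := (summable_nat_add_iff 2).2 (Real.summable_pow_mul_exp_neg_nat_mul n one_pos)
    refine (this.mul_left (Real.exp 2)).congr fun k => ?_
    have e : Real.exp (-k) = Real.exp 2 * Real.exp (-1 * ((k + 2 : ℕ) : ℝ)) := by
      rw [← Real.exp_add]; push_cast; ring_nf
    rw [e]; push_cast; ring
  set S := ∑' k : ℕ, Real.exp (-k) * ((k : ℝ) + 2) ^ n with hS
  have hS0 : 0 < S := hsum.tsum_pos (fun k => by positivity) 0 (by positivity)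
  refine ⟨γ * S, by positivity, fun t ht => ?_⟩
  -- The single term `k = ⌊t|p|⌋` of the sum already dominates.
  have hpt : ∀ᵐ p ∂μ, ENNReal.ofReal (Real.exp (t * p)) ≤
      ∑' k : ℕ, (Ioo (-((k + 2) / t)) 0).indicator
        (fun _ => ENNReal.ofReal (Real.exp (-(k : ℝ)))) p := by
    have : ∀ᵐ p ∂μ, p < 0 := by
      rw [ae_iff]; simpa [Ici] using hsupp
    filter_upwards [this] with p hp
    have h0 : 0 ≤ t * -p := by nlinarith
    refine le_trans ?_ (ENNReal.le_tsum ⌊t * -p⌋₊)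
    rw [indicator_of_mem]
    · refine ENNReal.ofReal_le_ofReal (Real.exp_le_exp.2 ?_)
      linarith [Nat.floor_le h0]
    · refine ⟨?_, hp⟩
      rw [neg_lt, lt_div_iff₀ ht]
      linarith [Nat.lt_floor_add_one (t * -p)]
  have key : ∫⁻ p, ENNReal.ofReal (Real.exp (t * p)) ∂μ ≤ ENNReal.ofReal (γ * S * t ^ (-β)) := by
    calc _ ≤ ∫⁻ p, ∑' k : ℕ, (Ioo (-((k + 2) / t)) 0).indicator
          (fun _ => ENNReal.ofReal (Real.exp (-(k : ℝ)))) p ∂μ := lintegral_mono_ae hpt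
      _ = ∑' k : ℕ, ENNReal.ofReal (Real.exp (-(k : ℝ))) * μ (Ioo (-(((k : ℝ) + 2) / t)) 0) := by
          rw [lintegral_tsum fun k => (measurable_const.indicator measurableSet_Ioo).aemeasurable]
          simp_rw [lintegral_indicator_const measurableSet_Ioo]
      _ ≤ ∑' k : ℕ, ENNReal.ofReal (γ * t ^ (-β) * (Real.exp (-k) * ((k : ℝ) + 2) ^ n)) := by
          refine ENNReal.tsum_le_tsum fun k => ?_
          grw [h (((k : ℝ) + 2) / t) (by positivity), ← ENNReal.ofReal_mul (by positivity)]
          refine ENNReal.ofReal_le_ofReal ?_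
          rw [Real.div_rpow (by positivity) ht.le, Real.rpow_neg ht.le, ← Real.rpow_natCast _ n]
          have : ((k : ℝ) + 2) ^ β ≤ ((k : ℝ) + 2) ^ (n : ℝ) :=
            Real.rpow_le_rpow_of_exponent_le (by linarith [k.cast_nonneg (α := ℝ)]) hn
          calc _ = γ * (t ^ β)⁻¹ * (Real.exp (-k) * ((k : ℝ) + 2) ^ β) := by ring
            _ ≤ _ := by gcongr
      _ = _ := by
          rw [← ENNReal.ofReal_tsum_of_nonneg (fun k => by positivity) (hsum.mul_left _),
            tsum_mul_left, ← hS]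
          ring_nf
  rw [impulseResponse, integral_eq_lintegral_of_nonneg_ae (ae_of_all _ fun p => by positivity)
    (by fun_prop)]
  exact ENNReal.toReal_le_of_le_ofReal (by positivity) key

theorem measurable_impulseResponse (μ : Measure ℝ) [SFinite μ] :
    Measurable (impulseResponse μ) := by
  have : StronglyMeasurable (Function.uncurry fun t p : ℝ => Real.exp (t * p)) := by
    apply Measurable.stronglyMeasurable
    simp only [Function.uncurry_def]
    fun_prop
  exact (this.integral_prod_right (ν := μ)).measurable

theorem impulseResponse_nonneg (μ : Measure ℝ) (t : ℝ) : 0 ≤ impulseResponse μ t :=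
  integral_nonneg fun _ => (Real.exp_pos _).le

/-! ### Decay implies boundedness -/

theorem eLpNorm_two_sq {X E : Type*} [MeasurableSpace X] [NormedAddCommGroup E] (f : X → E)
    (ν : Measure X) : eLpNorm f 2 ν ^ 2 = ∫⁻ x, ‖f x‖ₑ ^ 2 ∂ν := by
  simpa using eLpNorm_nnreal_pow_eq_lintegral (μ := ν) (f := f) (p := 2) two_ne_zero

theorem isBoundedHankel_of_le {h : ℝ → ℝ} {α B : ℝ} (hα : -1 / 2 < α) (hB : 0 < B)
    (hm : Measurable h) (h0 : ∀ t, 0 ≤ h t)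
    (hle : ∀ t, 0 < t → h t ≤ B * t ^ (-(1 + 2 * α))) :
    IsBoundedHankel h (fun t => t ^ α) := by
  have ha : 0 < α + 1 / 2 := by linarith
  set A : ℝ := B * (2 / (α + 1 / 2)) with hA
  have hA0 : 0 < A := by positivity
  refine ⟨A.toNNReal, fun u hu => ?_⟩
  change _ ∧ _ ∧ _ ≤ ENNReal.ofReal A * _
  set k : ℝ → ℝ → ℝ≥0∞ := fun t τ =>
    ENNReal.ofReal B * ENNReal.ofReal (t ^ α * τ ^ α * (t + τ) ^ (-(1 + 2 * α))) with hk
  set q : ℝ → ℝ≥0∞ := fun t => ENNReal.ofReal (t ^ (-1 / 2 : ℝ)) with hq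
  have hkm : Measurable (Function.uncurry k) := by
    simp only [hk, Function.uncurry_def]
    fun_prop
  have hqm : Measurable q := by fun_prop
  have hpos : ∀ᵐ t ∂halfLine, (0 : ℝ) < t := ae_restrict_mem measurableSet_Ioi
  have hrow : ∀ᵐ t ∂halfLine, ∫⁻ τ, k t τ * q τ ∂halfLine ≤ ENNReal.ofReal A * q t := by
    filter_upwards [hpos] with t ht
    have : Measurable fun τ => ENNReal.ofReal (t ^ α * τ ^ α * (t + τ) ^ (-(1 + 2 * α))) * q τ := by
      fun_prop
    simp_rw [hk, mul_assoc (ENNReal.ofReal B)]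
    rw [lintegral_const_mul _ this, hA, ENNReal.ofReal_mul hB.le, mul_assoc]
    gcongr
    exact lintegral_Ioi_rpow_mul_rpow_add_le hα ht
  have hsymm (t τ : ℝ) : k t τ = k τ t := by
    simp only [hk]; rw [mul_comm (t ^ α), add_comm t]
  have hcol : ∀ᵐ τ ∂halfLine, ∫⁻ t, k t τ * q t ∂halfLine ≤ ENNReal.ofReal A * q τ := by
    simpa only [hsymm] using hrow
  have hq0 : ∀ᵐ t ∂halfLine, q t ≠ 0 ∧ q t ≠ ∞ := by
    filter_upwards [hpos] with t ht
    exact ⟨(ENNReal.ofReal_pos.2 (by positivity)).ne', ENNReal.ofReal_ne_top⟩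
  have : SFinite halfLine := by unfold halfLine; infer_instance
  have hum : AEMeasurable (fun t => ‖u t‖ₑ) halfLine := hu.1.enorm
  -- `F` majorises the integral of absolute values, so its `L²` bound yields both a.e. absolute
  -- convergence and the norm estimate.
  set F : ℝ → ℝ≥0∞ := fun t => ∫⁻ τ, k t τ * ‖u τ‖ₑ ∂halfLine with hF
  have hFm : AEMeasurable F halfLine :=
    (hkm.aemeasurable.mul hum.comp_snd).lintegral_prod_right'
  have hFsq : ∫⁻ t, F t ^ 2 ∂halfLine ≤ (ENNReal.ofReal A * eLpNorm u 2 halfLine) ^ 2 := by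
    rw [mul_pow, eLpNorm_two_sq]
    exact lintegral_sq_lintegral_mul_le_of_schur _ hkm hqm hum hq0 hrow hcol
  have hFtop : ∫⁻ t, F t ^ 2 ∂halfLine ≠ ∞ :=
    (hFsq.trans_lt (ENNReal.pow_lt_top (ENNReal.mul_lt_top ENNReal.ofReal_lt_top hu.2))).ne
  have hjoint : AEStronglyMeasurable
      (fun z : ℝ × ℝ => hankelIntegrand h (fun t => t ^ α) u z.1 z.2) (halfLine.prod halfLine) := by
    unfold hankelIntegrand
    have : Measurable fun z : ℝ × ℝ => ((z.1 ^ α * h (z.1 + z.2) * z.2 ^ α : ℝ) : ℂ) := by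
      fun_prop
    exact this.aestronglyMeasurable.mul hu.1.comp_snd
  have hsec (t : ℝ) : AEStronglyMeasurable (hankelIntegrand h (fun t => t ^ α) u t) halfLine := by
    unfold hankelIntegrand
    have : Measurable fun τ : ℝ => ((t ^ α * h (t + τ) * τ ^ α : ℝ) : ℂ) := by
      fun_prop
    exact this.aestronglyMeasurable.mul hu.1
  have hbound : ∀ᵐ t ∂halfLine,
      ∫⁻ τ, ‖hankelIntegrand h (fun t => t ^ α) u t τ‖ₑ ∂halfLine ≤ F t := by
    filter_upwards [hpos] with t ht
    refine lintegral_mono_ae ?_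
    filter_upwards [hpos] with τ hτ
    have hh := h0 (t + τ)
    rw [hankelIntegrand, enorm_mul, hk]
    gcongr
    beta_reduce
    rw [← ENNReal.ofReal_mul hB.le, ← ofReal_norm, Complex.norm_real,
      Real.norm_of_nonneg (by positivity)]
    refine ENNReal.ofReal_le_ofReal ?_
    calc _ ≤ t ^ α * (B * (t + τ) ^ (-(1 + 2 * α))) * τ ^ α := by
          gcongr; exact hle _ (by positivity)
      _ = _ := by ring
  have hle2 : eLpNorm (weightedHankel h (fun t => t ^ α) u) 2 halfLine ≤
      ENNReal.ofReal A * eLpNorm u 2 halfLine := by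
    rw [← ENNReal.pow_le_pow_left_iff two_ne_zero, eLpNorm_two_sq]
    refine le_trans (lintegral_mono_ae ?_) hFsq
    filter_upwards [hbound] with t ht
    gcongr
    exact (enorm_integral_le_lintegral_enorm _).trans ht
  refine ⟨?_, ⟨hjoint.integral_prod_right', hle2.trans_lt
    (ENNReal.mul_lt_top ENNReal.ofReal_lt_top hu.2)⟩, hle2⟩
  filter_upwards [hbound, ae_lt_top' (hFm.pow_const 2) hFtop] with t ht hft
  refine ⟨hsec t, ht.trans_lt ?_⟩
  exact (ENNReal.pow_lt_top_iff.1 hft).resolve_right two_ne_zero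

/-! ### Boundedness implies growth -/

theorem impulseResponse_anti {μ : Measure ℝ} (hsupp : μ (Ici 0) = 0)
    (hfin : ∀ t : ℝ, 0 < t → Integrable (fun p : ℝ => Real.exp (t * p)) μ) {s t : ℝ}
    (hs : 0 < s) (hst : s ≤ t) : impulseResponse μ t ≤ impulseResponse μ s := by
  refine integral_mono_ae (hfin t (hs.trans_le hst)) (hfin s hs) ?_
  have : ∀ᵐ p ∂μ, p < 0 := by
    rw [ae_iff]; simpa [Ici] using hsupp
  filter_upwards [this] with p hp
  exact Real.exp_le_exp.2 (by nlinarith)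

/-- Markov's inequality: `e^c e^{cp/x} ≥ 1` on `(-x,0)`. -/
theorem measure_Ioo_zero_le_impulseResponse {μ : Measure ℝ}
    (hfin : ∀ t : ℝ, 0 < t → Integrable (fun p : ℝ => Real.exp (t * p)) μ) {x c : ℝ}
    (hx : 0 < x) (hc : 0 < c) :
    μ (Ioo (-x) 0) ≤ ENNReal.ofReal (Real.exp c * impulseResponse μ (c / x)) := by
  rw [impulseResponse, ← integral_const_mul, ofReal_integral_eq_lintegral_ofReal
    ((hfin _ (by positivity)).const_mul _) (ae_of_all _ fun p => by positivity),
    ← lintegral_indicator_one measurableSet_Ioo]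
  refine lintegral_mono fun p => indicator_apply_le' (fun hp => ?_) (fun _ => zero_le)
  rw [Pi.one_apply, ENNReal.one_le_ofReal, ← Real.exp_add, Real.one_le_exp_iff]
  have : c / x * -p ≤ c := by
    rw [div_mul_eq_mul_div, div_le_iff₀ hx]
    have := hp.1
    gcongr; linarith
  linarith

theorem min_one_two_rpow_mul_le {α x t : ℝ} (hx : 0 < x) (ht : t ∈ Ioo x (2 * x)) :
    min 1 (2 ^ α) * x ^ α ≤ t ^ α := by
  rcases le_total 0 α with h | h
  · calc _ ≤ 1 * x ^ α := by gcongr; exact min_le_left _ _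
      _ ≤ t ^ α := by rw [one_mul]; exact Real.rpow_le_rpow hx.le ht.1.le h
  · calc _ ≤ 2 ^ α * x ^ α := by gcongr; exact min_le_right _ _
      _ = (2 * x) ^ α := by rw [Real.mul_rpow zero_le_two hx.le]
      _ ≤ t ^ α := Real.rpow_le_rpow_of_nonpos (hx.trans ht.1) ht.2.le h

/-- For `t, τ` in `(x,2x)` one has `t + τ < 4x`, so the image of the indicator is at least `m`
there; the factor `x^{1/2}` in both norms cancels, leaving `m ≤ C`. -/
theorem exists_le_of_isBoundedHankel {h : ℝ → ℝ} {α : ℝ} (h0 : ∀ t, 0 ≤ h t)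
    (hanti : ∀ s t, 0 < s → s ≤ t → h t ≤ h s) (hb : IsBoundedHankel h (fun t => t ^ α)) :
    ∃ C : ℝ, 0 < C ∧ ∀ x : ℝ, 0 < x → h (4 * x) ≤ C * x ^ (-(1 + 2 * α)) := by
  obtain ⟨C, hC⟩ := hb
  set c : ℝ := min 1 (2 ^ α) with hc
  have hc0 : 0 < c := by positivity
  -- `C` may be 0; adding 1 keeps the constant positive.
  refine ⟨(C + 1) / c ^ 2, by positivity, fun x hx => ?_⟩
  have hsub : Ioo x (2 * x) ⊆ Ioi 0 := fun t ht => hx.trans ht.1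
  have hvol : halfLine (Ioo x (2 * x)) = ENNReal.ofReal x := by
    rw [halfLine, Measure.restrict_apply measurableSet_Ioo, inter_eq_left.2 hsub, Real.volume_Ioo]
    ring_nf
  set u : ℝ → ℂ := (Ioo x (2 * x)).indicator fun _ => 1 with hu
  have hum : MemLp u 2 halfLine :=
    memLp_indicator_const _ measurableSet_Ioo _ (Or.inr (by simp [hvol]))
  obtain ⟨hint, -, hle⟩ := hC u hum
  set m : ℝ := c ^ 2 * x ^ (1 + 2 * α) * h (4 * x) with hm
  have hm0 : 0 ≤ m := by have := h0 (4 * x); positivity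
  have hval (t : ℝ) : hankelIntegrand h (fun t => t ^ α) u t = fun τ =>
      (((Ioo x (2 * x)).indicator (fun τ => t ^ α * h (t + τ) * τ ^ α) τ : ℝ) : ℂ) := by
    ext τ
    by_cases hτ : τ ∈ Ioo x (2 * x) <;> simp [hankelIntegrand, hu, hτ]
  have hlow : ∀ᵐ t ∂halfLine, ‖(Ioo x (2 * x)).indicator (fun _ => m) t‖ ≤
      ‖weightedHankel h (fun t => t ^ α) u t‖ := by
    filter_upwards [hint] with t hit
    by_cases ht : t ∈ Ioo x (2 * x)
    swap; · simp [ht]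
    rw [indicator_of_mem ht, Real.norm_of_nonneg hm0, weightedHankel]
    rw [hval] at hit ⊢
    beta_reduce
    rw [integral_complex_ofReal, Complex.norm_real]
    refine le_trans ?_ (le_abs_self _)
    have e : m = ∫ τ, (Ioo x (2 * x)).indicator
        (fun _ => c * x ^ α * h (4 * x) * (c * x ^ α)) τ ∂halfLine := by
      rw [integral_indicator_const _ measurableSet_Ioo, measureReal_def, hvol,
        ENNReal.toReal_ofReal hx.le, hm, smul_eq_mul, Real.rpow_add hx, Real.rpow_one,
        two_mul, Real.rpow_add hx]
      ring
    rw [e]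
    refine integral_mono_of_nonneg (ae_of_all _ fun τ => indicator_nonneg (fun τ _ => ?_) τ)
      hit.re (ae_of_all _ fun τ => indicator_rel_indicator le_rfl fun hτ => ?_)
    · have := h0 (4 * x); positivity
    · have := h0 (4 * x)
      have ht0 : 0 < t := hsub ht
      have ht1 := h0 (t + τ)
      gcongr ?_ * ?_ * ?_
      · exact min_one_two_rpow_mul_le hx ht
      · exact hanti _ _ (add_pos ht0 (hsub hτ)) (by linarith [ht.2, hτ.2])
      · exact min_one_two_rpow_mul_le hx hτ
  have hnorm := (eLpNorm_mono_ae (p := 2) hlow).trans hle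
  rw [hu, eLpNorm_indicator_const measurableSet_Ioo two_ne_zero ENNReal.ofNat_ne_top,
    eLpNorm_indicator_const measurableSet_Ioo two_ne_zero ENNReal.ofNat_ne_top, hvol,
    ← mul_assoc, enorm_one, mul_one] at hnorm
  have hr0 : ENNReal.ofReal x ^ (1 / ENNReal.toReal 2) ≠ 0 := by
    simp [ENNReal.rpow_eq_zero_iff, hx]
  have hrt : ENNReal.ofReal x ^ (1 / ENNReal.toReal 2) ≠ ∞ := by
    simp
  rw [ENNReal.mul_le_mul_iff_left hr0 hrt, Real.enorm_of_nonneg hm0,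
    ← ENNReal.ofReal_coe_nnreal, ENNReal.ofReal_le_ofReal_iff C.coe_nonneg] at hnorm
  have hmul : x ^ (1 + 2 * α) * x ^ (-(1 + 2 * α)) = 1 := by
    rw [← Real.rpow_add hx, add_neg_cancel, Real.rpow_zero]
  calc h (4 * x) = m / c ^ 2 * x ^ (-(1 + 2 * α)) := by
        rw [hm, mul_assoc (c ^ 2), mul_div_cancel_left₀ _ (by positivity), mul_right_comm, hmul,
          one_mul]
    _ ≤ _ := by gcongr; linarith

theorem isBoundedHankel_iff_measure_Ioo_zero_le {α : ℝ} (hα : -1 / 2 < α) {μ : Measure ℝ}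
    [SFinite μ] (hsupp : μ (Ici 0) = 0)
    (hfin : ∀ t : ℝ, 0 < t → Integrable (fun p : ℝ => Real.exp (t * p)) μ) :
    IsBoundedHankel (impulseResponse μ) (fun t => t ^ α) ↔
      ∃ γ : ℝ, 0 < γ ∧ ∀ x : ℝ, 0 < x →
        μ (Ioo (-x) 0) ≤ ENNReal.ofReal (γ * x ^ (1 + 2 * α)) := by
  constructor
  · intro hb
    obtain ⟨C, hC0, hC⟩ := exists_le_of_isBoundedHankel (impulseResponse_nonneg μ)
      (fun s t hs hst => impulseResponse_anti hsupp hfin hs hst) hb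
    -- Markov with `c = 4` involves `h(4/x)`, which is the decay bound at `x⁻¹`.
    refine ⟨Real.exp 4 * C, by positivity, fun x hx => ?_⟩
    refine (measure_Ioo_zero_le_impulseResponse hfin hx four_pos).trans
      (ENNReal.ofReal_le_ofReal ?_)
    have := hC x⁻¹ (by positivity)
    rw [← Real.rpow_neg_eq_inv_rpow, neg_neg, ← div_eq_mul_inv] at this
    rw [mul_assoc]
    gcongr
  · rintro ⟨γ, hγ, h⟩
    obtain ⟨B, hB, hle⟩ := exists_impulseResponse_le hγ hsupp h
    exact isBoundedHankel_of_le hα hB (measurable_impulseResponse μ) (impulseResponse_nonneg μ) hle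

theorem theorem2p5 (α : ℝ) (μ : Measure ℝ) [SigmaFinite μ]
    (hsupp : μ (Ici 0) = 0)
    (hfin : ∀ t : ℝ, 0 < t → Integrable (fun p : ℝ => Real.exp (t * p)) μ) :
    (-1 / 2 < α → α < 0 →
      (IsBoundedHankel (impulseResponse μ) (fun t => t ^ α) ↔
        ∃ γ : ℝ, 0 < γ ∧ ∀ x : ℝ, 0 < x →
          μ (Ioo (-2 * x) (-x)) ≤ ENNReal.ofReal (γ * x ^ (1 + 2 * α)))) ∧
    (α = 0 →
      (IsBoundedHankel (impulseResponse μ) (fun t => t ^ α) ↔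
        ∃ γ : ℝ, 0 < γ ∧ ∀ x : ℝ, 0 < x →
          μ (Ioo (-x) 0) ≤ ENNReal.ofReal (γ * x))) ∧
    (0 < α →
      (IsBoundedHankel (impulseResponse μ) (fun t => t ^ α) ↔
        ∃ γ : ℝ, 0 < γ ∧ ∀ x : ℝ, 0 < x →
          μ (Ioo (-x) 0) ≤ ENNReal.ofReal (γ * x ^ (1 + 2 * α)))) := by
  refine ⟨fun hα _ => ?_, ?_, fun hα => ?_⟩
  · rw [isBoundedHankel_iff_measure_Ioo_zero_le hα hsupp hfin]
    refine ⟨fun ⟨γ, hγ, h⟩ => ⟨γ * 2 ^ (1 + 2 * α), by positivity, fun x hx => ?_⟩,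
      fun ⟨γ, hγ, h⟩ => exists_measure_Ioo_zero_le (by linarith) hγ h⟩
    have hsub : Ioo (-2 * x) (-x) ⊆ Ioo (-(2 * x)) 0 :=
      Ioo_subset_Ioo (by linarith) (by linarith)
    refine (measure_mono hsub).trans ((h _ (by positivity)).trans_eq ?_)
    rw [Real.mul_rpow zero_le_two hx.le, mul_assoc]
  · rintro rfl
    simpa using isBoundedHankel_iff_measure_Ioo_zero_le (α := 0) (by norm_num) hsupp hfin
  · exact isBoundedHankel_iff_measure_Ioo_zero_le (by linarith) hsupp hfin
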